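/- **Theorem (generalized Douglas–Rachford).** Let $U,V$ be linear subspaces of $\mathbb{R}^n$, let $\mu\in\mathbb{R}$, and put $$R:=P_UP_V+P_{U^\perp}P_{V^\perp},\qquad R_\mu:=(1-\mu)\,\mathrm{Id}+\mu R ,$$ where $P_W$ denotes the orthogonal projection onto $W$. An operator $A$ on $\mathbb{R}^n$ is *convergent to* $A^\infty$ if $\|A^k-A^\infty\|\to0$, and *convergent* if this holds for some $A^\infty$. A number $r\in[0,1)$ is a *convergence rate* of $A$ if there are $M,N>0$ with $\|A^k-A^\infty\|\le Mr^k$ for all integers $k>N$; the *optimal convergence rate* is the smallest convergence rate, if there is one. Let $\gamma(A):=\max\{|\lambda| : \lambda\in\{0\}\cup\sigma(A)\setminus\{1\}\}$, where $\sigma(A)$ is the set of complex eigenvalues of $A$. The Friedrichs angle $\theta_F\in[0,\pi/2]$ of $U$ and $V$ is given by $$\cos\theta_F=\max\{\langle u,v\rangle : u\in U\cap(U\cap V)^\perp,\ v\in V\cap(U\cap V)^\perp,\ \|u\|=\|v\|=1\},$$ with $\cos\theta_F:=0$ if there are no such $u,v$, that is, if $U\subseteq V$ or $V\subseteq U$.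 For $k\ge 1$, the $k$-th principal angle of $U$ and $V$ is $\theta_k=\arccos\langle u_k,v_k\rangle$, where successively for $i=1,\dots,k$ the pair $(u_i,v_i)$ maximizes $\langle u,v\rangle$ over unit vectors $u\in U$, $v\in V$ with $u\perp u_j$, $v\perp v_j$ for all $1\le j<i$. Then: 1. $R_\mu$ is normal. 2. If $U\ne V$, then $R_\mu$ is convergent if and only if $\mu\in[0,2)$. 3. If $\mu\in(0,2)$, then $\operatorname{Fix}R:=\{x: Rx=x\}=(U\cap V)\oplus(U^\perp\cap V^\perp)$, an orthogonal sum, and $R_\mu$ is convergent to $P_{\operatorname{Fix}R}=P_{(U\cap V)\oplus(U^\perp\cap V^\perp)}$. If moreover $U\neq V$, then $R_\mu$ has the optimal convergence rate $$\gamma(R_\mu)=\sqrt{\mu(2-\mu)\cos^2\theta_F+(1-\mu)^2},$$ and the same holds with $\theta_F$ replaced by the principal angle $\theta_{s+1}$, $s:=\dim(U\cap V)$, whenever the latter exists. -/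

import Mathlib

open Filter Topology
open scoped InnerProductSpace

/-- Euclidean space `ℝⁿ`. -/
abbrev Euc (n : ℕ) : Type := EuclideanSpace ℝ (Fin n)

/-- `A` is convergent to `L`: `‖A ^ k - L‖ → 0` as `k → ∞`, in the operator norm. -/
def ConvergesTo {n : ℕ} (A L : Euc n →L[ℝ] Euc n) : Prop :=
  Tendsto (fun k : ℕ => ‖A ^ k - L‖) atTop (𝓝 0)

/-- `A` is convergent: its powers converge to some operator. -/
def IsConvergent {n : ℕ} (A : Euc n →L[ℝ] Euc n) : Prop :=
  ∃ L : Euc n →L[ℝ] Euc n, ConvergesTo A L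

/-- `A` is linearly convergent to `L` with rate `r ∈ [0, 1)`: for some `M, N > 0`,
`‖A ^ k - L‖ ≤ M * r ^ k` for all natural `k > N`. -/
def IsConvergenceRate {n : ℕ} (A L : Euc n →L[ℝ] Euc n) (r : ℝ) : Prop :=
  0 ≤ r ∧ r < 1 ∧
    ∃ (M : ℝ) (N : ℕ), 0 < M ∧ 0 < N ∧ ∀ k : ℕ, N < k → ‖A ^ k - L‖ ≤ M * r ^ k

/-- `r` is the optimal convergence rate: the infimum of all the convergence rates of `A`,
and itself a convergence rate. -/
def IsOptimalConvergenceRate {n : ℕ} (A L : Euc n →L[ℝ] Euc n) (r : ℝ) : Prop :=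
  IsLeast {t : ℝ | IsConvergenceRate A L t} r

/-- The set of complex eigenvalues of the real operator `A`, that is, the spectrum over `ℂ` of
its matrix in the standard basis. -/
noncomputable def complexSpectrum {n : ℕ} (A : Euc n →L[ℝ] Euc n) : Set ℂ :=
  spectrum ℂ (((Matrix.toEuclideanCLM (n := Fin n) (𝕜 := ℝ)).symm A).map (algebraMap ℝ ℂ))

/-- `γ(A) = max {|z| : z ∈ {0} ∪ σ(A) \ {1}}`; the set is finite and contains `0`, so the
supremum is a maximum. -/
noncomputable def subdominantModulus {n : ℕ} (A : Euc n →L[ℝ] Euc n) : ℝ :=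
  sSup ((fun z : ℂ => ‖z‖) '' ({0} ∪ complexSpectrum A \ {1}))

/-- The set `Fix A = {x | A x = x}` of fixed points, as a subspace. -/
def fixedSpace {n : ℕ} (A : Euc n →L[ℝ] Euc n) : Submodule ℝ (Euc n) :=
  LinearMap.eqLocus (A : Euc n →ₗ[ℝ] Euc n) LinearMap.id

/-- The cosine of the Friedrichs angle: the maximum of `⟪u, v⟫` over unit vectors
`u ∈ U ∩ (U ∩ V)ᗮ` and `v ∈ V ∩ (U ∩ V)ᗮ`. When there are no such vectors, that is, when
one of `U`, `V` contains the other, the value is `sSup ∅ = 0`, the usual convention. -/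
noncomputable def friedrichsCos {n : ℕ} (U V : Submodule ℝ (Euc n)) : ℝ :=
  sSup {c : ℝ | ∃ u ∈ U ⊓ (U ⊓ V)ᗮ, ∃ v ∈ V ⊓ (U ⊓ V)ᗮ, ‖u‖ = 1 ∧ ‖v‖ = 1 ∧ c = ⟪u, v⟫_ℝ}

/-- The Friedrichs angle of `U` and `V`. -/
noncomputable def friedrichsAngle {n : ℕ} (U V : Submodule ℝ (Euc n)) : ℝ :=
  Real.arccos (friedrichsCos U V)

/-- `(x, y)` is admissible at step `i` for given `u₁, …, uᵢ₋₁` and `v₁, …, vᵢ₋₁`: unit vectors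
`x ∈ U` and `y ∈ V` with `x ⟂ uⱼ` and `y ⟂ vⱼ` for `1 ≤ j < i`. -/
def PrincipalAdmissible {n : ℕ} (U V : Submodule ℝ (Euc n)) (u v : ℕ → Euc n) (i : ℕ)
    (x y : Euc n) : Prop :=
  x ∈ U ∧ y ∈ V ∧ ‖x‖ = 1 ∧ ‖y‖ = 1 ∧
    ∀ j : ℕ, 1 ≤ j → j < i → ⟪x, u j⟫_ℝ = 0 ∧ ⟪y, v j⟫_ℝ = 0

/-- `θ` is the `k`-th principal angle of `U` and `V` (`k ≥ 1`): there are successive pairs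
`(u₁, v₁), …, (uₖ, vₖ)`, each maximizing `⟪x, y⟫` over the pairs admissible at its step, with
`θ = arccos ⟪uₖ, vₖ⟫`. -/
def IsPrincipalAngle {n : ℕ} (U V : Submodule ℝ (Euc n)) (k : ℕ) (θ : ℝ) : Prop :=
  1 ≤ k ∧ ∃ u v : ℕ → Euc n,
    (∀ i : ℕ, 1 ≤ i → i ≤ k →
      PrincipalAdmissible U V u v i (u i) (v i) ∧
        ∀ x y : Euc n, PrincipalAdmissible U V u v i x y → ⟪x, y⟫_ℝ ≤ ⟪u i, v i⟫_ℝ) ∧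
    θ = Real.arccos ⟪u k, v k⟫_ℝ

/-- The Douglas–Rachford operator `R = P_U P_V + P_{Uᗮ} P_{Vᗮ}`; here `W.starProjection` is the
orthogonal projection onto `W` and the product is composition. -/
noncomputable def douglasRachford {n : ℕ} (U V : Submodule ℝ (Euc n)) : Euc n →L[ℝ] Euc n :=
  U.starProjection * V.starProjection + Uᗮ.starProjection * Vᗮ.starProjection

/-- The generalized Douglas–Rachford operator `R_μ = (1 - μ) Id + μ R`. -/
noncomputable def generalizedDouglasRachford {n : ℕ} (U V : Submodule ℝ (Euc n)) (μ : ℝ) :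
    Euc n →L[ℝ] Euc n :=
  (1 - μ) • (1 : Euc n →L[ℝ] Euc n) + μ • douglasRachford U V

/-!
Write `P`, `Q` for the orthogonal projections onto `U`, `V` and `D = P - Q`. Expanding products of
idempotents gives two identities for `T = R_μ`, whose adjoint is `R_μ` with `U` and `V` exchanged:
`T* T = 1 - μ (2 - μ) D²` and `T + T* = 2 - 2 μ D²`. The first is symmetric in `U` and `V`, so `T`
is normal. Evaluated on vectors, the two say `‖T x‖² = ‖x‖² - μ (2 - μ) ‖D x‖²` and
`‖x - T x‖² = μ² ‖D x‖²`; hence for `μ ≠ 0` the fixed vectors of `T` form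
`ker D = (U ∩ V) ⊕ (Uᗮ ∩ Vᗮ)`, and the behaviour of `T` on the complement of `ker D` is governed by
the spectrum of the self-adjoint operator `D²`, which commutes with `T`.

For `U ≠ V` the smallest nonzero eigenvalue of `D²` is `m = sin² θ_F`. It bounds `D²` from below
on `(ker D)ᗮ` (`le_norm_sq_projDiff`): for vectors of `U` and of `V` this is the definition of the
Friedrichs angle, and `D` carries the remaining vectors, those of `Uᗮ`, back to `V`. It is attained
(`friedrichsCos_lt_one_and_exists_eigenvector`), because a pair of unit vectors at the Friedrichs
angle satisfies `Q u = c v`, `P v = c u` with `c = cos θ_F`.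

With `ρ = 1 - μ (2 - μ) m = μ (2 - μ) c² + (1 - μ)²`, the operator `T` therefore contracts
`(ker D)ᗮ` by the factor `√ρ`, and `‖T^k x‖ = √ρ^k ‖x‖` for an eigenvector `x` of `D²` for `m`. The
first gives the convergence with rate `√ρ` and bounds the eigenvalues other than `1`; the second
shows that the rate is optimal and that the powers diverge for `μ` outside `[0, 2)`, where `1 ≤ ρ`.
On that eigenspace `T² - 2 (1 - μ m) T + ρ = 0`, so a complex eigenvalue of modulus `√ρ` exists.

The principal angle `θ_{s+1}` equals the Friedrichs angle because the first `s = dim (U ∩ V)`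
principal pairs are pairs of equal vectors that span `U ∩ V`.
-/

/-! ### Algebra of two projections -/

section Algebra

variable {A : Type*} [Ring A] [Algebra ℝ A]

/-- The element `(1 - μ) + μ (p q + (1 - p) (1 - q))` of an algebra. For the orthogonal projections
`p`, `q` onto two subspaces it is their generalized Douglas–Rachford operator. -/
def drPolynomial (p q : A) (μ : ℝ) : A :=
  (1 - μ) • (1 : A) + μ • (p * q + (1 - p) * (1 - q))

theorem star_drPolynomial [StarRing A] [StarModule ℝ A] {p q : A} (hp : IsStarProjection p)
    (hq : IsStarProjection q) (μ : ℝ) : star (drPolynomial p q μ) = drPolynomial q p μ := by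
  simp only [drPolynomial, star_add, star_smul, star_mul, star_sub, star_one, star_trivial,
    hp.isSelfAdjoint.star_eq, hq.isSelfAdjoint.star_eq]

theorem drPolynomial_add_swap {p q : A} (hp : IsIdempotentElem p) (hq : IsIdempotentElem q)
    (μ : ℝ) : drPolynomial p q μ + drPolynomial q p μ =
      (2 : ℝ) • 1 - (2 * μ) • ((p - q) * (p - q)) := by
  simp only [drPolynomial, mul_sub, sub_mul, mul_one, one_mul, hp.eq, hq.eq]
  module

theorem drPolynomial_swap_mul {p q : A} (hp : IsIdempotentElem p) (hq : IsIdempotentElem q)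
    (μ : ℝ) : drPolynomial q p μ * drPolynomial p q μ =
      1 - (μ * (2 - μ)) • ((p - q) * (p - q)) := by
  have hp' (x : A) : p * (p * x) = p * x := by rw [← mul_assoc, hp.eq]
  simp only [drPolynomial, mul_add, mul_sub, add_mul, sub_mul, smul_mul_assoc, mul_smul_comm,
    mul_one, one_mul, mul_assoc, hp.eq, hq.eq, hp']
  module

theorem commute_sub_mul_self_drPolynomial {p q : A} (hp : IsIdempotentElem p)
    (hq : IsIdempotentElem q) (μ : ℝ) : Commute ((p - q) * (p - q)) (drPolynomial p q μ) := by
  have hp' (x : A) : p * (p * x) = p * x := by rw [← mul_assoc, hp.eq]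
  have hq' (x : A) : q * (q * x) = q * x := by rw [← mul_assoc, hq.eq]
  rw [Commute, SemiconjBy]
  simp only [drPolynomial, mul_add, mul_sub, add_mul, sub_mul, smul_mul_assoc, mul_smul_comm,
    mul_one, one_mul, mul_assoc, hp.eq, hq.eq, hp', hq']
  module

theorem drPolynomial_mul_self {p q : A} (hp : IsIdempotentElem p) (hq : IsIdempotentElem q)
    (μ : ℝ) : drPolynomial p q μ * drPolynomial p q μ =
      (2 : ℝ) • drPolynomial p q μ - (2 * μ) • (drPolynomial p q μ * ((p - q) * (p - q)))
        - (1 - (μ * (2 - μ)) • ((p - q) * (p - q))) := by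
  rw [← drPolynomial_swap_mul hp hq, ← (commute_sub_mul_self_drPolynomial hp hq μ).eq]
  have h := congrArg (· * drPolynomial p q μ) (drPolynomial_add_swap hp hq μ)
  simp only [add_mul, sub_mul _ _ (drPolynomial p q μ), smul_mul_assoc, one_mul] at h
  rw [← h]
  abel

end Algebra

/-! ### The difference of the two projections -/

/-- The difference `P_U - P_V` of the orthogonal projections onto `U` and `V`. -/
noncomputable def projDiff {n : ℕ} (U V : Submodule ℝ (Euc n)) : Euc n →L[ℝ] Euc n :=
  U.starProjection - V.starProjection

section Operators

variable {n : ℕ} (U V : Submodule ℝ (Euc n)) (μ : ℝ)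

theorem projDiff_swap : projDiff V U = -projDiff U V :=
  (neg_sub _ _).symm

theorem inner_projDiff_left (x y : Euc n) : ⟪projDiff U V x, y⟫_ℝ = ⟪x, projDiff U V y⟫_ℝ := by
  simp [projDiff, inner_sub_left, inner_sub_right, Submodule.inner_starProjection_left_eq_right]

theorem star_projDiff : star (projDiff U V) = projDiff U V :=
  ((isSelfAdjoint_starProjection U).sub (isSelfAdjoint_starProjection V)).star_eq

theorem generalizedDouglasRachford_eq : generalizedDouglasRachford U V μ =
    drPolynomial U.starProjection V.starProjection μ := by
  simp only [generalizedDouglasRachford, douglasRachford, Submodule.starProjection_orthogonal']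
  rfl

/-- Taking adjoints of the generalized Douglas–Rachford operator exchanges the two subspaces. -/
theorem star_generalizedDouglasRachford :
    star (generalizedDouglasRachford U V μ) = generalizedDouglasRachford V U μ := by
  rw [generalizedDouglasRachford_eq, generalizedDouglasRachford_eq]
  exact star_drPolynomial isStarProjection_starProjection isStarProjection_starProjection μ

theorem generalizedDouglasRachford_swap_mul :
    generalizedDouglasRachford V U μ * generalizedDouglasRachford U V μ =
      1 - (μ * (2 - μ)) • (projDiff U V * projDiff U V) := by
  rw [generalizedDouglasRachford_eq, generalizedDouglasRachford_eq]
  exact drPolynomial_swap_mul (Submodule.isIdempotentElem_starProjection U)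
    (Submodule.isIdempotentElem_starProjection V) μ

theorem generalizedDouglasRachford_add_swap :
    generalizedDouglasRachford U V μ + generalizedDouglasRachford V U μ =
      (2 : ℝ) • 1 - (2 * μ) • (projDiff U V * projDiff U V) := by
  rw [generalizedDouglasRachford_eq, generalizedDouglasRachford_eq]
  exact drPolynomial_add_swap (Submodule.isIdempotentElem_starProjection U)
    (Submodule.isIdempotentElem_starProjection V) μ

theorem isStarNormal_generalizedDouglasRachford :
    IsStarNormal (generalizedDouglasRachford U V μ) := by
  have h : projDiff V U * projDiff V U = projDiff U V * projDiff U V := by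
    rw [projDiff_swap U V]
    exact neg_mul_neg (projDiff U V) (projDiff U V)
  refine ⟨?_⟩
  rw [star_generalizedDouglasRachford, Commute, SemiconjBy, generalizedDouglasRachford_swap_mul,
    generalizedDouglasRachford_swap_mul, h]

theorem projDiff_mul_self_commute : Commute (projDiff U V * projDiff U V)
    (generalizedDouglasRachford U V μ) := by
  rw [generalizedDouglasRachford_eq]
  exact commute_sub_mul_self_drPolynomial (Submodule.isIdempotentElem_starProjection U)
    (Submodule.isIdempotentElem_starProjection V) μ

/-- A quadratic equation for `R_μ` over the commuting operator `(P_U - P_V)²`, obtained by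
eliminating the adjoint from `R_μ + R_μ*` and `R_μ* R_μ`. -/
theorem generalizedDouglasRachford_mul_self :
    generalizedDouglasRachford U V μ * generalizedDouglasRachford U V μ =
      (2 : ℝ) • generalizedDouglasRachford U V μ
        - (2 * μ) • (generalizedDouglasRachford U V μ * (projDiff U V * projDiff U V))
        - (1 - (μ * (2 - μ)) • (projDiff U V * projDiff U V)) := by
  rw [generalizedDouglasRachford_eq]
  exact drPolynomial_mul_self (Submodule.isIdempotentElem_starProjection U)
    (Submodule.isIdempotentElem_starProjection V) μ

theorem inner_generalizedDouglasRachford_left (x y : Euc n) :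
    ⟪generalizedDouglasRachford U V μ x, y⟫_ℝ = ⟪x, generalizedDouglasRachford V U μ y⟫_ℝ := by
  rw [← star_generalizedDouglasRachford U V, ContinuousLinearMap.star_eq_adjoint,
    ContinuousLinearMap.adjoint_inner_right]

theorem norm_sq_generalizedDouglasRachford (x : Euc n) :
    ‖generalizedDouglasRachford U V μ x‖ ^ 2 =
      ‖x‖ ^ 2 - μ * (2 - μ) * ‖projDiff U V x‖ ^ 2 := by
  have h := congrArg (fun A : Euc n →L[ℝ] Euc n => ⟪x, A x⟫_ℝ)
    (generalizedDouglasRachford_swap_mul U V μ)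
  simp only [mul_apply_eq_comp, sub_apply,
    smul_apply, one_apply_eq_self, inner_sub_right,
    inner_smul_right, ← inner_projDiff_left, ← inner_generalizedDouglasRachford_left,
    real_inner_self_eq_norm_sq] at h
  exact h

theorem inner_self_generalizedDouglasRachford (x : Euc n) :
    ⟪x, generalizedDouglasRachford U V μ x⟫_ℝ = ‖x‖ ^ 2 - μ * ‖projDiff U V x‖ ^ 2 := by
  have h := congrArg (fun A : Euc n →L[ℝ] Euc n => ⟪x, A x⟫_ℝ)
    (generalizedDouglasRachford_add_swap U V μ)
  simp only [mul_apply_eq_comp, sub_apply,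
    add_apply, inner_add_right,
    smul_apply, one_apply_eq_self, inner_sub_right,
    inner_smul_right, ← inner_projDiff_left, real_inner_self_eq_norm_sq] at h
  have h' := inner_generalizedDouglasRachford_left U V μ x x
  rw [real_inner_comm] at h'
  linarith

theorem norm_sq_sub_generalizedDouglasRachford (x : Euc n) :
    ‖x - generalizedDouglasRachford U V μ x‖ ^ 2 = μ ^ 2 * ‖projDiff U V x‖ ^ 2 := by
  rw [norm_sub_sq_real, inner_self_generalizedDouglasRachford, norm_sq_generalizedDouglasRachford]
  ring

variable {μ}

theorem generalizedDouglasRachford_apply_eq_self_iff (hμ : μ ≠ 0) (x : Euc n) :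
    generalizedDouglasRachford U V μ x = x ↔ projDiff U V x = 0 := by
  have h := norm_sq_sub_generalizedDouglasRachford U V μ x
  rw [eq_comm, ← sub_eq_zero, ← norm_eq_zero, ← norm_eq_zero (a := projDiff U V x),
    ← sq_eq_zero_iff, h, mul_eq_zero, sq_eq_zero_iff, sq_eq_zero_iff]
  simp [hμ]

theorem inf_isOrtho_inf_orthogonal : (U ⊓ V) ⟂ (Uᗮ ⊓ Vᗮ) :=
  (Submodule.isOrtho_orthogonal_right U).mono inf_le_left inf_le_left

/-- `P_U` and `P_V` agree exactly on `(U ∩ V) ⊕ (Uᗮ ∩ Vᗮ)`. -/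
theorem projDiff_apply_eq_zero_iff (x : Euc n) :
    projDiff U V x = 0 ↔ x ∈ (U ⊓ V) ⊔ (Uᗮ ⊓ Vᗮ) := by
  constructor
  · intro h
    have h : U.starProjection x = V.starProjection x := sub_eq_zero.mp h
    rw [Submodule.mem_sup]
    refine ⟨U.starProjection x, ⟨U.starProjection_apply_mem x, ?_⟩,
      x - U.starProjection x, ⟨U.sub_starProjection_mem_orthogonal x, ?_⟩, by abel⟩
    · rw [h]; exact V.starProjection_apply_mem x
    · rw [h]; exact V.sub_starProjection_mem_orthogonal x
  · intro h
    obtain ⟨a, ha, b, hb, rfl⟩ := Submodule.mem_sup.mp h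
    simp [projDiff, Submodule.starProjection_eq_self_iff.mpr ha.1,
      Submodule.starProjection_eq_self_iff.mpr ha.2,
      U.starProjection_apply_eq_zero_iff.mpr hb.1, V.starProjection_apply_eq_zero_iff.mpr hb.2]

theorem fixedSpace_douglasRachford :
    fixedSpace (douglasRachford U V) = (U ⊓ V) ⊔ (Uᗮ ⊓ Vᗮ) := by
  ext x
  rw [← projDiff_apply_eq_zero_iff,
    ← generalizedDouglasRachford_apply_eq_self_iff U V one_ne_zero]
  simp [fixedSpace, generalizedDouglasRachford]

theorem ker_projDiff : (projDiff U V).ker = (U ⊓ V) ⊔ (Uᗮ ⊓ Vᗮ) := by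
  ext x
  rw [← projDiff_apply_eq_zero_iff, LinearMap.mem_ker]
  rfl

variable {U V}

/-- By self-adjointness, every vector orthogonal to the kernel of `P_U - P_V` lies in its range;
the preimage can be taken orthogonal to the kernel too. -/
theorem exists_projDiff_eq {y : Euc n} (hy : y ∈ ((U ⊓ V) ⊔ (Uᗮ ⊓ Vᗮ))ᗮ) :
    ∃ x ∈ ((U ⊓ V) ⊔ (Uᗮ ⊓ Vᗮ))ᗮ, projDiff U V x = y := by
  have h : ((projDiff U V).range)ᗮ = (U ⊓ V) ⊔ (Uᗮ ⊓ Vᗮ) := by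
    rw [ContinuousLinearMap.orthogonal_range, ← ContinuousLinearMap.star_eq_adjoint,
      star_projDiff, ker_projDiff]
  rw [← h, Submodule.orthogonal_orthogonal] at hy
  obtain ⟨x, hx⟩ := hy
  set K := (U ⊓ V) ⊔ (Uᗮ ⊓ Vᗮ)
  refine ⟨x - K.starProjection x, K.sub_starProjection_mem_orthogonal x, ?_⟩
  rw [map_sub, (projDiff_apply_eq_zero_iff U V _).mpr (K.starProjection_apply_mem x), sub_zero]
  exact hx

/-! ### The Friedrichs angle as the spectral gap of `(P_U - P_V)²` -/

variable (U V)

theorem inf_orthogonal_eq_bot_iff : U ⊓ (U ⊓ V)ᗮ = ⊥ ↔ U ≤ V := by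
  constructor
  · intro h
    have := Submodule.sup_orthogonal_inf_of_hasOrthogonalProjection (inf_le_left : U ⊓ V ≤ U)
    rw [inf_comm (U ⊓ V)ᗮ, h, sup_bot_eq] at this
    exact inf_eq_left.mp this
  · intro h
    rw [inf_eq_left.mpr h, Submodule.inf_orthogonal_eq_bot]

theorem friedrichsCos_comm : friedrichsCos U V = friedrichsCos V U := by
  unfold friedrichsCos
  congr 1
  ext c
  constructor
  · rintro ⟨u, hu, v, hv, h1, h2, rfl⟩
    rw [inf_comm U V] at hu hv
    exact ⟨v, hv, u, hu, h2, h1, real_inner_comm _ _⟩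
  · rintro ⟨u, hu, v, hv, h1, h2, rfl⟩
    rw [inf_comm V U] at hu hv
    exact ⟨v, hv, u, hu, h2, h1, real_inner_comm _ _⟩

theorem friedrichsCos_le_one : friedrichsCos U V ≤ 1 := by
  refine Real.sSup_le ?_ zero_le_one
  rintro c ⟨u, -, v, -, h1, h2, rfl⟩
  simpa [h1, h2] using real_inner_le_norm u v

theorem friedrichsCos_nonneg : 0 ≤ friedrichsCos U V := by
  by_cases h : ∃ u ∈ U ⊓ (U ⊓ V)ᗮ, ∃ v ∈ V ⊓ (U ⊓ V)ᗮ, ‖u‖ = 1 ∧ ‖v‖ = 1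
  · obtain ⟨u, hu, v, hv, h1, h2⟩ := h
    apply Real.sSup_nonneg'
    rcases le_total 0 ⟪u, v⟫_ℝ with h0 | h0
    · exact ⟨_, ⟨u, hu, v, hv, h1, h2, rfl⟩, h0⟩
    · exact ⟨_, ⟨-u, neg_mem hu, v, hv, by simpa, h2, rfl⟩, by simpa⟩
  · apply Real.sSup_nonneg
    rintro c ⟨u, hu, v, hv, h1, h2, -⟩
    exact absurd ⟨u, hu, v, hv, h1, h2⟩ h

variable {U V}

theorem inner_le_friedrichsCos {u v : Euc n} (hu : u ∈ U ⊓ (U ⊓ V)ᗮ) (hv : v ∈ V ⊓ (U ⊓ V)ᗮ) :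
    ⟪u, v⟫_ℝ ≤ friedrichsCos U V * (‖u‖ * ‖v‖) := by
  rcases eq_or_ne u 0 with rfl | hu0
  · simp
  rcases eq_or_ne v 0 with rfl | hv0
  · simp
  have hu1 := norm_pos_iff.mpr hu0
  have hv1 := norm_pos_iff.mpr hv0
  have h : ⟪‖u‖⁻¹ • u, ‖v‖⁻¹ • v⟫_ℝ ≤ friedrichsCos U V := by
    refine le_csSup ⟨1, ?_⟩ ⟨_, Submodule.smul_mem _ _ hu, _, Submodule.smul_mem _ _ hv,
      norm_smul_inv_norm hu0, norm_smul_inv_norm hv0, rfl⟩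
    rintro c ⟨u, -, v, -, h1, h2, rfl⟩
    simpa [h1, h2] using real_inner_le_norm u v
  rw [real_inner_smul_left, real_inner_smul_right, ← mul_assoc, ← mul_inv,
    inv_mul_le_iff₀ (by positivity)] at h
  linarith

theorem starProjection_mem_orthogonal_inf {u : Euc n} (hu : u ∈ (U ⊓ V)ᗮ) :
    V.starProjection u ∈ V ⊓ (U ⊓ V)ᗮ := by
  refine ⟨V.starProjection_apply_mem u, fun w hw => ?_⟩
  rw [← Submodule.inner_starProjection_left_eq_right,
    Submodule.starProjection_eq_self_iff.mpr hw.2]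
  exact hu w hw

theorem norm_starProjection_le_friedrichsCos {u : Euc n} (hu : u ∈ U ⊓ (U ⊓ V)ᗮ) :
    ‖V.starProjection u‖ ≤ friedrichsCos U V * ‖u‖ := by
  have h := inner_le_friedrichsCos hu (starProjection_mem_orthogonal_inf hu.2)
  have h2 : ⟪u, V.starProjection u⟫_ℝ = ‖V.starProjection u‖ ^ 2 := by
    rw [← real_inner_self_eq_norm_sq, Submodule.inner_starProjection_left_eq_right,
      Submodule.starProjection_eq_self_iff.mpr (V.starProjection_apply_mem u)]
  rcases (norm_nonneg (V.starProjection u)).eq_or_lt with h0 | h0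
  · rw [← h0]
    exact mul_nonneg (friedrichsCos_nonneg U V) (norm_nonneg _)
  · rw [h2, sq, ← mul_assoc] at h
    exact le_of_mul_le_mul_right h h0

theorem norm_sq_projDiff_of_mem_left {u : Euc n} (hu : u ∈ U) :
    ‖projDiff U V u‖ ^ 2 = ‖u‖ ^ 2 - ‖V.starProjection u‖ ^ 2 := by
  have h := Submodule.norm_sq_eq_add_norm_sq_starProjection u V
  rw [Submodule.starProjection_orthogonal_val] at h
  simp only [projDiff, sub_apply, Submodule.starProjection_eq_self_iff.mpr hu]
  linarith

theorem le_norm_sq_projDiff_of_mem_left {u : Euc n} (hu : u ∈ U ⊓ (U ⊓ V)ᗮ) :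
    (1 - friedrichsCos U V ^ 2) * ‖u‖ ^ 2 ≤ ‖projDiff U V u‖ ^ 2 := by
  rw [norm_sq_projDiff_of_mem_left hu.1]
  have := pow_le_pow_left₀ (norm_nonneg _) (norm_starProjection_le_friedrichsCos hu) 2
  rw [mul_pow] at this
  linarith

theorem le_norm_sq_projDiff_of_mem_right {v : Euc n} (hv : v ∈ V ⊓ (U ⊓ V)ᗮ) :
    (1 - friedrichsCos U V ^ 2) * ‖v‖ ^ 2 ≤ ‖projDiff U V v‖ ^ 2 := by
  rw [inf_comm U V] at hv
  simpa [projDiff_swap U V, friedrichsCos_comm V U] using le_norm_sq_projDiff_of_mem_left hv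

theorem mem_orthogonal_inf_of_mem_orthogonal {y : Euc n}
    (hy : y ∈ ((U ⊓ V) ⊔ (Uᗮ ⊓ Vᗮ))ᗮ) : y ∈ (U ⊓ V)ᗮ :=
  Submodule.orthogonal_le le_sup_left hy

/-- The bound `‖D z‖² ≥ m ‖z‖²` on a vector `z` passes to the vector `D z` by the Cauchy–Schwarz
inequality. -/
theorem le_norm_sq_projDiff_projDiff {z : Euc n} {m : ℝ}
    (hz : m * ‖z‖ ^ 2 ≤ ‖projDiff U V z‖ ^ 2) :
    m * ‖projDiff U V z‖ ^ 2 ≤ ‖projDiff U V (projDiff U V z)‖ ^ 2 := by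
  rcases eq_or_ne z 0 with rfl | hz0
  · simp
  have hz1 : 0 < ‖z‖ ^ 2 := by positivity
  have h1 : ‖projDiff U V z‖ ^ 2 ≤ ‖z‖ * ‖projDiff U V (projDiff U V z)‖ := by
    rw [← real_inner_self_eq_norm_sq, inner_projDiff_left]
    exact real_inner_le_norm _ _
  have h2 := pow_le_pow_left₀ (by positivity) h1 2
  rw [mul_pow] at h2
  have h3 := mul_le_mul_of_nonneg_right hz (sq_nonneg ‖projDiff U V z‖)
  refine le_of_mul_le_mul_left ?_ hz1
  nlinarith

/-- On the orthogonal complement of its kernel, `(P_U - P_V)²` is bounded below by `sin² θ_F`.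
Both `U` and `Uᗮ` are invariant under `(P_U - P_V)²`. On the component in `U` the bound is the
definition of the angle; the component in `Uᗮ` is the image under `P_U - P_V` of a vector of `V`,
because `(1 - P_U) (P_U - P_V) = (P_U - P_V) P_V`. -/
theorem le_norm_sq_projDiff {y : Euc n} (hy : y ∈ ((U ⊓ V) ⊔ (Uᗮ ⊓ Vᗮ))ᗮ) :
    (1 - friedrichsCos U V ^ 2) * ‖y‖ ^ 2 ≤ ‖projDiff U V y‖ ^ 2 := by
  obtain ⟨x, hx, rfl⟩ := exists_projDiff_eq hy
  set D := projDiff U V with hD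
  set y := D x
  have hU (z : Euc n) : U.starProjection (U.starProjection z) = U.starProjection z :=
    Submodule.starProjection_eq_self_iff.mpr (U.starProjection_apply_mem z)
  have hV (z : Euc n) : V.starProjection (V.starProjection z) = V.starProjection z :=
    Submodule.starProjection_eq_self_iff.mpr (V.starProjection_apply_mem z)
  have e1 : Uᗮ.starProjection y = D (V.starProjection x) := by
    simp only [y, hD, projDiff, Submodule.starProjection_orthogonal_val,
      sub_apply, map_sub, hU, hV]
    abel
  have e2 : D (U.starProjection y) = Vᗮ.starProjection (D y) := by
    simp only [hD, projDiff, Submodule.starProjection_orthogonal_val,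
      sub_apply, map_sub, hU, hV]
    abel
  have e3 : D (Uᗮ.starProjection y) = V.starProjection (D y) := by
    simp only [hD, projDiff, Submodule.starProjection_orthogonal_val,
      sub_apply, map_sub, hU, hV]
    abel
  have p1 := Submodule.norm_sq_eq_add_norm_sq_starProjection y U
  have p2 := Submodule.norm_sq_eq_add_norm_sq_starProjection (D y) V
  rw [← e2, ← e3] at p2
  have b1 : (1 - friedrichsCos U V ^ 2) * ‖U.starProjection y‖ ^ 2 ≤
      ‖D (U.starProjection y)‖ ^ 2 := by
    apply le_norm_sq_projDiff_of_mem_left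
    rw [inf_comm U V]
    apply starProjection_mem_orthogonal_inf
    rw [inf_comm V U]
    exact mem_orthogonal_inf_of_mem_orthogonal hy
  have b2 : (1 - friedrichsCos U V ^ 2) * ‖Uᗮ.starProjection y‖ ^ 2 ≤
      ‖D (Uᗮ.starProjection y)‖ ^ 2 := by
    rw [e1]
    apply le_norm_sq_projDiff_projDiff
    apply le_norm_sq_projDiff_of_mem_right
    exact starProjection_mem_orthogonal_inf (mem_orthogonal_inf_of_mem_orthogonal hx)
  rw [p1, p2]
  linarith

/-- If neither subspace contains the other, the maximum defining the Friedrichs angle is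
attained, by compactness. -/
theorem exists_inner_eq_friedrichsCos (hUV : ¬U ≤ V) (hVU : ¬V ≤ U) :
    ∃ u ∈ U ⊓ (U ⊓ V)ᗮ, ∃ v ∈ V ⊓ (U ⊓ V)ᗮ, ‖u‖ = 1 ∧ ‖v‖ = 1 ∧
      friedrichsCos U V = ⟪u, v⟫_ℝ := by
  have key : IsCompact {c : ℝ | ∃ u ∈ U ⊓ (U ⊓ V)ᗮ, ∃ v ∈ V ⊓ (U ⊓ V)ᗮ,
      ‖u‖ = 1 ∧ ‖v‖ = 1 ∧ c = ⟪u, v⟫_ℝ} := by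
    have h (W : Submodule ℝ (Euc n)) : IsCompact (Metric.sphere (0 : Euc n) 1 ∩ (W : Set (Euc n))) :=
      (isCompact_sphere _ _).inter_right W.closed_of_finiteDimensional
    convert ((h (U ⊓ (U ⊓ V)ᗮ)).prod (h (V ⊓ (U ⊓ V)ᗮ))).image
      (f := fun p : Euc n × Euc n => ⟪p.1, p.2⟫_ℝ) (by fun_prop) using 1
    ext c
    constructor
    · rintro ⟨u, hu, v, hv, h1, h2, rfl⟩
      exact ⟨(u, v), ⟨⟨by simpa using h1, hu⟩, ⟨by simpa using h2, hv⟩⟩, rfl⟩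
    · rintro ⟨⟨u, v⟩, ⟨⟨h1, hu⟩, ⟨h2, hv⟩⟩, rfl⟩
      exact ⟨u, hu, v, hv, by simpa using h1, by simpa using h2, rfl⟩
  refine key.sSup_mem ?_
  have hu := mt (inf_orthogonal_eq_bot_iff U V).mp hUV
  have hv := mt (inf_orthogonal_eq_bot_iff V U).mp hVU
  rw [inf_comm V U] at hv
  obtain ⟨u, hu, hu0⟩ := Submodule.exists_mem_ne_zero_of_ne_bot hu
  obtain ⟨v, hv, hv0⟩ := Submodule.exists_mem_ne_zero_of_ne_bot hv
  exact ⟨_, _, Submodule.smul_mem _ _ hu, _, Submodule.smul_mem _ _ hv,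
    norm_smul_inv_norm hu0, norm_smul_inv_norm hv0, rfl⟩

theorem friedrichsCos_eq_zero_of_le (h : U ≤ V) : friedrichsCos U V = 0 := by
  refine le_antisymm (Real.sSup_le ?_ le_rfl) (friedrichsCos_nonneg U V)
  rintro c ⟨u, hu, v, -, -, -, rfl⟩
  rw [(inf_orthogonal_eq_bot_iff U V).mpr h, Submodule.mem_bot] at hu
  simp [hu]

/-- Equality in the Cauchy–Schwarz inequality: if the projection of `u` has norm at most `c` and
`⟪u, v⟫ = c` for a unit vector `v ∈ V`, then the projection of `u` onto `V` is `c • v`. -/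
theorem starProjection_eq_smul {u v : Euc n} {c : ℝ} (hv : v ∈ V) (hv1 : ‖v‖ = 1)
    (hc : ⟪u, v⟫_ℝ = c) (hle : ‖V.starProjection u‖ ^ 2 ≤ c ^ 2) :
    V.starProjection u = c • v := by
  rw [← sub_eq_zero, ← norm_eq_zero, ← sq_eq_zero_iff]
  refine le_antisymm ?_ (sq_nonneg _)
  rw [norm_sub_sq_real, real_inner_smul_right, norm_smul, hv1,
    Submodule.inner_starProjection_left_eq_right, Submodule.starProjection_eq_self_iff.mpr hv, hc,
    mul_one, Real.norm_eq_abs, sq_abs]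
  linarith

theorem exists_projDiff_projDiff_eq_of_lt (h : U < V) :
    ∃ x : Euc n, x ≠ 0 ∧ projDiff U V (projDiff U V x) = (1 - friedrichsCos U V ^ 2) • x := by
  have hv := mt (inf_orthogonal_eq_bot_iff V U).mp h.not_ge
  rw [inf_eq_right.mpr h.le] at hv
  obtain ⟨x, hx, hx0⟩ := Submodule.exists_mem_ne_zero_of_ne_bot hv
  refine ⟨x, hx0, ?_⟩
  rw [friedrichsCos_eq_zero_of_le h.le]
  simp [projDiff, Submodule.starProjection_eq_self_iff.mpr hx.1,
    U.starProjection_apply_eq_zero_iff.mpr hx.2]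

variable (U V)

/-- The bound `sin² θ_F` is attained: it is an eigenvalue of `(P_U - P_V)²`, and it is nonzero.
The eigenvector is a vector at the Friedrichs angle or, if one subspace contains the other, a
vector of the larger one orthogonal to the smaller. -/
theorem friedrichsCos_lt_one_and_exists_eigenvector (h : U ≠ V) :
    friedrichsCos U V < 1 ∧ ∃ x : Euc n, x ≠ 0 ∧
      projDiff U V (projDiff U V x) = (1 - friedrichsCos U V ^ 2) • x := by
  by_cases hUV : U ≤ V
  · exact ⟨by rw [friedrichsCos_eq_zero_of_le hUV]; exact one_pos,
      exists_projDiff_projDiff_eq_of_lt (lt_of_le_of_ne hUV h)⟩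
  by_cases hVU : V ≤ U
  · obtain ⟨x, hx0, hx⟩ := exists_projDiff_projDiff_eq_of_lt (lt_of_le_of_ne hVU h.symm)
    rw [friedrichsCos_comm U V]
    refine ⟨by rw [friedrichsCos_eq_zero_of_le hVU]; exact one_pos, x, hx0, ?_⟩
    simpa [projDiff_swap U V] using hx
  obtain ⟨u, hu, v, hv, hu1, hv1, hc⟩ := exists_inner_eq_friedrichsCos hUV hVU
  set c := friedrichsCos U V with hcdef
  constructor
  · refine lt_of_le_of_ne (friedrichsCos_le_one U V) fun h1 => ?_
    rw [hc, inner_eq_one_iff_of_norm_eq_one hu1 hv1] at h1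
    subst h1
    have := hu.2 u ⟨hu.1, hv.1⟩
    rw [inner_self_eq_zero] at this
    simp [this] at hu1
  -- The maximizing pair satisfies `P_V u = c v` and `P_U v = c u`.
  have e1 : V.starProjection u = c • v := by
    refine starProjection_eq_smul hv.1 hv1 hc.symm ?_
    have := norm_starProjection_le_friedrichsCos hu
    rw [hu1, mul_one] at this
    exact pow_le_pow_left₀ (norm_nonneg _) this 2
  have e2 : U.starProjection v = c • u := by
    refine starProjection_eq_smul hu.1 hu1 (by rw [real_inner_comm, hc]) ?_
    have hv' := hv
    rw [inf_comm U V] at hv'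
    have := norm_starProjection_le_friedrichsCos hv'
    rw [hv1, mul_one, friedrichsCos_comm V U] at this
    exact pow_le_pow_left₀ (norm_nonneg _) this 2
  refine ⟨v, by rintro rfl; simp at hv1, ?_⟩
  simp only [projDiff, sub_apply, map_sub, map_smul, e1, e2,
    Submodule.starProjection_eq_self_iff.mpr hv.1, Submodule.starProjection_eq_self_iff.mpr hu.1]
  module

end Operators

section Powers

variable {n : ℕ} (U V : Submodule ℝ (Euc n)) (μ : ℝ)

/-! ### Powers of the generalized Douglas–Rachford operator -/

theorem friedrichsCos_lt_one : friedrichsCos U V < 1 := by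
  rcases eq_or_ne U V with rfl | h
  · rw [friedrichsCos_eq_zero_of_le le_rfl]
    exact one_pos
  · exact (friedrichsCos_lt_one_and_exists_eigenvector U V h).1

theorem one_sub_friedrichsCos_sq_pos : 0 < 1 - friedrichsCos U V ^ 2 := by
  nlinarith [friedrichsCos_nonneg U V, friedrichsCos_lt_one U V]

/-- The number `√(μ (2 - μ) cos² θ_F + (1 - μ)²)`. -/
noncomputable def friedrichsRate : ℝ :=
  Real.sqrt (μ * (2 - μ) * friedrichsCos U V ^ 2 + (1 - μ) ^ 2)

theorem friedrichsRate_nonneg : 0 ≤ friedrichsRate U V μ := Real.sqrt_nonneg _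

/-- The radicand equals `(1 - μ sin² θ_F)² + (μ sin θ_F cos θ_F)²`, so it is never negative. -/
theorem friedrichsRate_sq :
    friedrichsRate U V μ ^ 2 = 1 - μ * (2 - μ) * (1 - friedrichsCos U V ^ 2) := by
  rw [friedrichsRate, Real.sq_sqrt]
  · ring
  · have h := mul_nonneg (mul_nonneg (sq_nonneg μ) (one_sub_friedrichsCos_sq_pos U V).le)
      (sq_nonneg (friedrichsCos U V))
    nlinarith [sq_nonneg (1 - μ * (1 - friedrichsCos U V ^ 2))]

variable {μ}

theorem friedrichsRate_lt_one (h0 : 0 < μ) (h2 : μ < 2) : friedrichsRate U V μ < 1 := by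
  rw [← sq_lt_one_iff₀ (friedrichsRate_nonneg U V μ), friedrichsRate_sq]
  have := mul_pos (mul_pos h0 (sub_pos.mpr h2)) (one_sub_friedrichsCos_sq_pos U V)
  linarith

variable {U V}

theorem generalizedDouglasRachford_apply_of_mem {x : Euc n} (hx : x ∈ (U ⊓ V) ⊔ (Uᗮ ⊓ Vᗮ)) :
    generalizedDouglasRachford U V μ x = x := by
  have h := norm_sq_sub_generalizedDouglasRachford U V μ x
  rw [(projDiff_apply_eq_zero_iff U V x).mpr hx] at h
  rw [eq_comm, ← sub_eq_zero, ← norm_eq_zero, ← sq_eq_zero_iff, h]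
  simp

theorem generalizedDouglasRachford_mem_orthogonal {y : Euc n}
    (hy : y ∈ ((U ⊓ V) ⊔ (Uᗮ ⊓ Vᗮ))ᗮ) :
    generalizedDouglasRachford U V μ y ∈ ((U ⊓ V) ⊔ (Uᗮ ⊓ Vᗮ))ᗮ := by
  intro k hk
  rw [← inner_generalizedDouglasRachford_left, generalizedDouglasRachford_apply_of_mem]
  · exact hy k hk
  · rwa [inf_comm V U, inf_comm Vᗮ Uᗮ]

theorem norm_generalizedDouglasRachford_le (h0 : 0 ≤ μ) (h2 : μ ≤ 2) {y : Euc n}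
    (hy : y ∈ ((U ⊓ V) ⊔ (Uᗮ ⊓ Vᗮ))ᗮ) :
    ‖generalizedDouglasRachford U V μ y‖ ≤ friedrichsRate U V μ * ‖y‖ := by
  refine le_of_sq_le_sq ?_ (mul_nonneg (friedrichsRate_nonneg U V μ) (norm_nonneg y))
  rw [mul_pow, friedrichsRate_sq, norm_sq_generalizedDouglasRachford]
  have := mul_le_mul_of_nonneg_left (le_norm_sq_projDiff hy) (mul_nonneg h0 (sub_nonneg.mpr h2))
  linarith

theorem generalizedDouglasRachford_pow_apply_of_mem {x : Euc n}
    (hx : x ∈ (U ⊓ V) ⊔ (Uᗮ ⊓ Vᗮ)) (k : ℕ) :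
    (generalizedDouglasRachford U V μ ^ k) x = x := by
  induction k with
  | zero => simp
  | succ k ih => rw [pow_succ, mul_apply_eq_comp, generalizedDouglasRachford_apply_of_mem hx, ih]

theorem norm_generalizedDouglasRachford_pow_le (h0 : 0 ≤ μ) (h2 : μ ≤ 2) {y : Euc n}
    (hy : y ∈ ((U ⊓ V) ⊔ (Uᗮ ⊓ Vᗮ))ᗮ) (k : ℕ) :
    ‖(generalizedDouglasRachford U V μ ^ k) y‖ ≤ friedrichsRate U V μ ^ k * ‖y‖ := by
  induction k generalizing y with
  | zero => simp
  | succ k ih =>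
    rw [pow_succ, mul_apply_eq_comp, pow_succ, mul_assoc]
    exact (ih (generalizedDouglasRachford_mem_orthogonal hy)).trans
      (mul_le_mul_of_nonneg_left (norm_generalizedDouglasRachford_le h0 h2 hy)
        (pow_nonneg (friedrichsRate_nonneg U V μ) k))

theorem norm_generalizedDouglasRachford_pow_sub_le (h0 : 0 ≤ μ) (h2 : μ ≤ 2) (k : ℕ) :
    ‖generalizedDouglasRachford U V μ ^ k - ((U ⊓ V) ⊔ (Uᗮ ⊓ Vᗮ)).starProjection‖ ≤
      friedrichsRate U V μ ^ k := by
  set K := (U ⊓ V) ⊔ (Uᗮ ⊓ Vᗮ) with hK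
  refine ContinuousLinearMap.opNorm_le_bound _ (pow_nonneg (friedrichsRate_nonneg U V μ) k)
    fun x => ?_
  have h : (generalizedDouglasRachford U V μ ^ k - K.starProjection) x =
      (generalizedDouglasRachford U V μ ^ k) (x - K.starProjection x) := by
    rw [map_sub, generalizedDouglasRachford_pow_apply_of_mem (K.starProjection_apply_mem x)]
    rfl
  rw [h]
  refine (norm_generalizedDouglasRachford_pow_le h0 h2
    (K.sub_starProjection_mem_orthogonal x) k).trans ?_
  refine mul_le_mul_of_nonneg_left ?_ (pow_nonneg (friedrichsRate_nonneg U V μ) k)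
  have := Submodule.norm_sq_eq_add_norm_sq_starProjection x K
  rw [Submodule.starProjection_orthogonal_val] at this
  exact le_of_sq_le_sq (by nlinarith [sq_nonneg ‖K.starProjection x‖]) (norm_nonneg _)

variable (U V)

theorem convergesTo_generalizedDouglasRachford (h0 : 0 < μ) (h2 : μ < 2) :
    ConvergesTo (generalizedDouglasRachford U V μ)
      ((U ⊓ V) ⊔ (Uᗮ ⊓ Vᗮ)).starProjection :=
  squeeze_zero (fun _ => norm_nonneg _)
    (norm_generalizedDouglasRachford_pow_sub_le h0.le h2.le)
    (tendsto_pow_atTop_nhds_zero_of_lt_one (friedrichsRate_nonneg U V μ)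
      (friedrichsRate_lt_one U V h0 h2))

variable {U V}

/-! ### Orbits of eigenvectors of `(P_U - P_V)²` -/

variable {x : Euc n} {m : ℝ}

theorem projDiff_projDiff_pow_apply (hx : projDiff U V (projDiff U V x) = m • x) (k : ℕ) :
    projDiff U V (projDiff U V ((generalizedDouglasRachford U V μ ^ k) x)) =
      m • (generalizedDouglasRachford U V μ ^ k) x := by
  have h := congrArg (fun A : Euc n →L[ℝ] Euc n => A x)
    ((projDiff_mul_self_commute U V μ).pow_right k).eq
  simp only [mul_apply_eq_comp, hx, map_smul] at h
  exact h

theorem norm_sq_projDiff_of_eigenvector (hx : projDiff U V (projDiff U V x) = m • x) :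
    ‖projDiff U V x‖ ^ 2 = m * ‖x‖ ^ 2 := by
  rw [← real_inner_self_eq_norm_sq, inner_projDiff_left, hx, inner_smul_right,
    real_inner_self_eq_norm_sq]

/-- On an eigenspace of `(P_U - P_V)²` the operator `R_μ` is a multiple of an isometry. -/
theorem norm_sq_generalizedDouglasRachford_pow
    (hx : projDiff U V (projDiff U V x) = m • x) (k : ℕ) :
    ‖(generalizedDouglasRachford U V μ ^ k) x‖ ^ 2 =
      (1 - μ * (2 - μ) * m) ^ k * ‖x‖ ^ 2 := by
  induction k with
  | zero => simp
  | succ k ih =>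
    rw [pow_succ' (generalizedDouglasRachford U V μ), mul_apply_eq_comp,
      norm_sq_generalizedDouglasRachford,
      norm_sq_projDiff_of_eigenvector (projDiff_projDiff_pow_apply hx k), ih]
    ring

theorem mem_orthogonal_of_eigenvector (hm : m ≠ 0)
    (hx : projDiff U V (projDiff U V x) = m • x) : x ∈ ((U ⊓ V) ⊔ (Uᗮ ⊓ Vᗮ))ᗮ := by
  intro k hk
  have h : m * ⟪k, x⟫_ℝ = 0 := by
    rw [← real_inner_smul_right, ← hx, ← inner_projDiff_left,
      (projDiff_apply_eq_zero_iff U V k).mpr hk, inner_zero_left]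
  exact (mul_eq_zero.mp h).resolve_left hm

theorem le_of_pow_le_mul_pow {a t M : ℝ} {N : ℕ} (ha : 0 ≤ a) (ht : 0 ≤ t)
    (h : ∀ k, N < k → a ^ k ≤ M * t ^ k) : a ≤ t := by
  by_contra! hlt
  have ha' : 0 < a := ht.trans_lt hlt
  have hlim := (tendsto_pow_atTop_nhds_zero_of_lt_one (div_nonneg ht ha)
    ((div_lt_one ha').mpr hlt)).const_mul M
  rw [mul_zero] at hlim
  obtain ⟨k, hk1, hk2⟩ := ((hlim.eventually_lt_const one_pos).and (eventually_gt_atTop N)).exists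
  have := h k hk2
  rw [div_pow, mul_div_assoc', div_lt_one (pow_pos ha' k)] at hk1
  linarith

variable (U V)

theorem isOptimalConvergenceRate_friedrichsRate (hUV : U ≠ V) (h0 : 0 < μ) (h2 : μ < 2) :
    IsOptimalConvergenceRate (generalizedDouglasRachford U V μ)
      ((U ⊓ V) ⊔ (Uᗮ ⊓ Vᗮ)).starProjection (friedrichsRate U V μ) := by
  refine ⟨⟨friedrichsRate_nonneg U V μ, friedrichsRate_lt_one U V h0 h2, 1, 1, one_pos, one_pos,
    fun k _ => ?_⟩, ?_⟩
  · rw [one_mul]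
    exact norm_generalizedDouglasRachford_pow_sub_le h0.le h2.le k
  rintro t ⟨ht, -, M, N, -, -, h⟩
  obtain ⟨-, x, hx0, hx⟩ := friedrichsCos_lt_one_and_exists_eigenvector U V hUV
  refine le_of_pow_le_mul_pow (friedrichsRate_nonneg U V μ) ht (M := M) (N := N) fun k hk => ?_
  have hL := ((U ⊓ V) ⊔ (Uᗮ ⊓ Vᗮ)).starProjection_apply_eq_zero_iff.mpr
    (mem_orthogonal_of_eigenvector (one_sub_friedrichsCos_sq_pos U V).ne' hx)
  have e : ‖(generalizedDouglasRachford U V μ ^ k) x‖ = friedrichsRate U V μ ^ k * ‖x‖ := by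
    rw [← sq_eq_sq₀ (norm_nonneg _)
      (mul_nonneg (pow_nonneg (friedrichsRate_nonneg U V μ) k) (norm_nonneg x)),
      norm_sq_generalizedDouglasRachford_pow hx, mul_pow, ← friedrichsRate_sq, pow_right_comm]
  have b := ContinuousLinearMap.le_opNorm (generalizedDouglasRachford U V μ ^ k -
    ((U ⊓ V) ⊔ (Uᗮ ⊓ Vᗮ)).starProjection) x
  rw [sub_apply, hL, sub_zero, e] at b
  exact (le_of_mul_le_mul_right b (norm_pos_iff.mpr hx0)).trans (h k hk)

/-- Outside `[0, 2)` the orbit of an eigenvector of `(P_U - P_V)²` for the eigenvalue `sin² θ_F`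
does not decrease in norm, so its limit would be a nonzero eigenvector fixed by `R_μ`; but
`P_U - P_V` annihilates the fixed vectors. -/
theorem not_isConvergent_generalizedDouglasRachford (hUV : U ≠ V) (hμ : μ < 0 ∨ 2 ≤ μ) :
    ¬IsConvergent (generalizedDouglasRachford U V μ) := by
  rintro ⟨L, hL⟩
  have hL : Tendsto (fun k => generalizedDouglasRachford U V μ ^ k) atTop (𝓝 L) :=
    tendsto_iff_norm_sub_tendsto_zero.mpr hL
  obtain ⟨-, x, hx0, hx⟩ := friedrichsCos_lt_one_and_exists_eigenvector U V hUV
  have hm := one_sub_friedrichsCos_sq_pos U V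
  set m := 1 - friedrichsCos U V ^ 2
  have hLx : Tendsto (fun k => (generalizedDouglasRachford U V μ ^ k) x) atTop (𝓝 (L x)) :=
    ((ContinuousLinearMap.apply ℝ (Euc n) x).continuous.tendsto L).comp hL
  have hfix : generalizedDouglasRachford U V μ (L x) = L x := by
    refine tendsto_nhds_unique
      (((generalizedDouglasRachford U V μ).continuous.tendsto _).comp hLx) ?_
    have h := hLx.comp (tendsto_add_atTop_nat 1)
    refine h.congr fun k => ?_
    simp only [Function.comp_apply]
    rw [pow_succ', mul_apply_eq_comp]
  have hD0 : projDiff U V (L x) = 0 :=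
    (generalizedDouglasRachford_apply_eq_self_iff U V
      (by rcases hμ with h | h <;> linarith) _).mp hfix
  have hD : projDiff U V (projDiff U V (L x)) = m • L x := by
    refine tendsto_nhds_unique ?_ (hLx.const_smul m)
    refine ((((projDiff U V).continuous.comp (projDiff U V).continuous).tendsto _).comp
      hLx).congr fun k => ?_
    exact projDiff_projDiff_pow_apply hx k
  rw [hD0, map_zero, eq_comm, smul_eq_zero_iff_right hm.ne'] at hD
  have hnorm : ‖x‖ ^ 2 ≤ ‖L x‖ ^ 2 := by
    refine ge_of_tendsto (hLx.norm.pow 2) (Eventually.of_forall fun k => ?_)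
    have hρ : 1 ≤ 1 - μ * (2 - μ) * m := by
      have : μ * (2 - μ) ≤ 0 := by rcases hμ with h | h <;> nlinarith
      nlinarith
    rw [norm_sq_generalizedDouglasRachford_pow hx]
    exact le_mul_of_one_le_left (sq_nonneg _) (one_le_pow₀ hρ)
  rw [hD, norm_zero] at hnorm
  have := norm_pos_iff.mpr hx0
  nlinarith

theorem isConvergent_generalizedDouglasRachford_iff (hUV : U ≠ V) :
    IsConvergent (generalizedDouglasRachford U V μ) ↔ 0 ≤ μ ∧ μ < 2 := by
  constructor
  · intro h
    by_contra hμ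
    refine not_isConvergent_generalizedDouglasRachford U V hUV ?_ h
    by_contra! h'
    exact hμ h'
  · rintro ⟨h0, h2⟩
    rcases h0.eq_or_lt with rfl | h0
    · refine ⟨1, ?_⟩
      have h : generalizedDouglasRachford U V 0 = 1 := by
        rw [generalizedDouglasRachford, sub_zero, one_smul]
        exact (congrArg (1 + ·) (zero_smul ℝ (douglasRachford U V))).trans (add_zero _)
      simp only [ConvergesTo, h, one_pow]
      refine tendsto_const_nhds.congr fun _ => ?_
      rw [eq_comm, norm_eq_zero]
      exact sub_self _
    · exact ⟨_, convergesTo_generalizedDouglasRachford U V h0 h2⟩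

/-! ### Complex eigenvalues -/

variable {U V}

/-- Complex eigenvectors in real terms: `x + i y` is an eigenvector for `z`. -/
theorem mem_complexSpectrum_iff (A : Euc n →L[ℝ] Euc n) (z : ℂ) :
    z ∈ complexSpectrum A ↔ ∃ x y : Euc n, (x ≠ 0 ∨ y ≠ 0) ∧
      A x = z.re • x - z.im • y ∧ A y = z.im • x + z.re • y := by
  obtain ⟨B, rfl⟩ : ∃ B, A = Matrix.toEuclideanCLM (n := Fin n) (𝕜 := ℝ) B :=
    ⟨_, (StarAlgEquiv.apply_symm_apply _ A).symm⟩
  rw [complexSpectrum, StarAlgEquiv.symm_apply_apply, ← Matrix.spectrum_toLin',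
    ← Module.End.hasEigenvalue_iff_mem_spectrum]
  constructor
  · intro h
    obtain ⟨w, hw⟩ := h.exists_hasEigenvector
    have hw0 := hw.2
    have hw1 := hw.apply_eq_smul
    rw [Matrix.toLin'_apply] at hw1
    refine ⟨WithLp.toLp 2 fun j => (w j).re, WithLp.toLp 2 fun j => (w j).im, ?_, ?_, ?_⟩
    · by_contra! h
      refine hw0 (funext fun j => Complex.ext ?_ ?_)
      · simpa using congrArg (fun v : Euc n => v j) h.1
      · simpa using congrArg (fun v : Euc n => v j) h.2
    · ext i
      simpa [Matrix.toEuclideanCLM_toLp, Matrix.mulVec, dotProduct] using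
        congrArg Complex.re (congrFun hw1 i)
    · ext i
      have := congrArg Complex.im (congrFun hw1 i)
      simp [Matrix.mulVec, dotProduct] at this
      simp [Matrix.toEuclideanCLM_toLp, Matrix.mulVec, dotProduct, this]
      ring
  · rintro ⟨x, y, h0, hx, hy⟩
    refine Module.End.hasEigenvalue_of_hasEigenvector
      (x := fun j => (x j : ℂ) + (y j : ℂ) * Complex.I) ⟨?_, ?_⟩
    · rw [Module.End.mem_eigenspace_iff, Matrix.toLin'_apply]
      ext i
      have hx' := congrArg (fun v : Euc n => v i) hx
      have hy' := congrArg (fun v : Euc n => v i) hy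
      simp [Matrix.mulVec, dotProduct] at hx' hy'
      apply Complex.ext
      · simp [Matrix.mulVec, dotProduct, hx']
      · simp [Matrix.mulVec, dotProduct, hy']
        ring
    · intro h
      rcases h0 with h0 | h0
      · exact h0 (by ext j; simpa using congrArg Complex.re (congrFun h j))
      · exact h0 (by ext j; simpa using congrArg Complex.im (congrFun h j))

theorem starProjection_generalizedDouglasRachford (x : Euc n) :
    ((U ⊓ V) ⊔ (Uᗮ ⊓ Vᗮ)).starProjection (generalizedDouglasRachford U V μ x) =
      ((U ⊓ V) ⊔ (Uᗮ ⊓ Vᗮ)).starProjection x := by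
  set K := (U ⊓ V) ⊔ (Uᗮ ⊓ Vᗮ)
  have h : generalizedDouglasRachford U V μ x =
      K.starProjection x + generalizedDouglasRachford U V μ (x - K.starProjection x) := by
    rw [map_sub, generalizedDouglasRachford_apply_of_mem (K.starProjection_apply_mem x)]
    abel
  rw [h, map_add, K.starProjection_apply_eq_zero_iff.mpr (generalizedDouglasRachford_mem_orthogonal
    (K.sub_starProjection_mem_orthogonal x)), add_zero]
  exact Submodule.starProjection_eq_self_iff.mpr (K.starProjection_apply_mem x)

/-- An eigenvalue other than `1` has its eigenvectors orthogonal to the fixed vectors, where `R_μ`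
contracts by the factor `friedrichsRate U V μ`. -/
theorem norm_le_friedrichsRate_of_mem_complexSpectrum (h0 : 0 ≤ μ) (h2 : μ ≤ 2) {z : ℂ}
    (hz : z ∈ complexSpectrum (generalizedDouglasRachford U V μ)) (hz1 : z ≠ 1) :
    ‖z‖ ≤ friedrichsRate U V μ := by
  obtain ⟨x, y, hxy, hx, hy⟩ := (mem_complexSpectrum_iff _ _).mp hz
  set a := z.re
  set b := z.im
  have hab : (a - 1) ^ 2 + b ^ 2 ≠ 0 := by
    intro h
    rw [add_eq_zero_iff_of_nonneg (sq_nonneg _) (sq_nonneg _), sq_eq_zero_iff, sq_eq_zero_iff,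
      sub_eq_zero] at h
    exact hz1 (Complex.ext h.1 h.2)
  have hmem : x ∈ ((U ⊓ V) ⊔ (Uᗮ ⊓ Vᗮ))ᗮ ∧ y ∈ ((U ⊓ V) ⊔ (Uᗮ ⊓ Vᗮ))ᗮ := by
    rw [← Submodule.starProjection_apply_eq_zero_iff, ← Submodule.starProjection_apply_eq_zero_iff]
    have px := congrArg ((U ⊓ V) ⊔ (Uᗮ ⊓ Vᗮ)).starProjection hx
    have py := congrArg ((U ⊓ V) ⊔ (Uᗮ ⊓ Vᗮ)).starProjection hy
    rw [starProjection_generalizedDouglasRachford] at px py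
    simp only [map_sub, map_add, map_smul] at px py
    set p := ((U ⊓ V) ⊔ (Uᗮ ⊓ Vᗮ)).starProjection x
    set q := ((U ⊓ V) ⊔ (Uᗮ ⊓ Vᗮ)).starProjection y
    have px' : (a - 1) • p - b • q = 0 := by
      linear_combination (norm := module) (-1 : ℝ) • px
    have py' : b • p + (a - 1) • q = 0 := by
      linear_combination (norm := module) -py
    constructor
    · have : ((a - 1) ^ 2 + b ^ 2) • p = 0 := by
        linear_combination (norm := module) (a - 1) • px' + b • py'
      exact (smul_eq_zero_iff_right hab).mp this
    · have : ((a - 1) ^ 2 + b ^ 2) • q = 0 := by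
        linear_combination (norm := module) (a - 1) • py' - b • px'
      exact (smul_eq_zero_iff_right hab).mp this
  have hpos : 0 < ‖x‖ ^ 2 + ‖y‖ ^ 2 := by
    rcases hxy with h | h
    · have := norm_pos_iff.mpr h
      positivity
    · have := norm_pos_iff.mpr h
      positivity
  have bx := pow_le_pow_left₀ (norm_nonneg _) (norm_generalizedDouglasRachford_le h0 h2 hmem.1) 2
  have hb := pow_le_pow_left₀ (norm_nonneg _) (norm_generalizedDouglasRachford_le h0 h2 hmem.2) 2
  rw [hx, mul_pow, norm_sub_sq_real] at bx
  rw [hy, mul_pow, norm_add_sq_real] at hb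
  simp only [real_inner_smul_left, real_inner_smul_right, norm_smul, mul_pow, Real.norm_eq_abs,
    sq_abs] at bx hb
  refine le_of_sq_le_sq (le_of_mul_le_mul_right ?_ hpos) (friedrichsRate_nonneg U V μ)
  rw [← Complex.normSq_eq_norm_sq, Complex.normSq_apply]
  linarith

variable (U V)

/-- With `m = sin² θ_F`, the numbers `a ± i b`, `a = 1 - μ m`, `a² + b² = 1 - μ (2 - μ) m`, are the
roots of the quadratic polynomial that annihilates `R_μ` on the eigenspace of `(P_U - P_V)²` for
`m`. -/
theorem exists_mem_complexSpectrum_norm_eq (hUV : U ≠ V) (hμ : μ ≠ 0) :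
    ∃ z ∈ complexSpectrum (generalizedDouglasRachford U V μ), z ≠ 1 ∧
      ‖z‖ = friedrichsRate U V μ := by
  obtain ⟨-, x, hx0, hx⟩ := friedrichsCos_lt_one_and_exists_eigenvector U V hUV
  have hm := one_sub_friedrichsCos_sq_pos U V
  have hρ := friedrichsRate_sq U V μ
  have hmc : (1 - (1 - friedrichsCos U V ^ 2)) = friedrichsCos U V ^ 2 := by ring
  set m := 1 - friedrichsCos U V ^ 2
  set T := generalizedDouglasRachford U V μ with hT
  set a := 1 - μ * m with ha
  obtain ⟨b, hb⟩ : ∃ b : ℝ, a ^ 2 + b ^ 2 = 1 - μ * (2 - μ) * m := by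
    refine ⟨μ * friedrichsCos U V * Real.sqrt m, ?_⟩
    rw [mul_pow, mul_pow, ← hmc, Real.sq_sqrt hm.le]
    ring
  have hTT : T (T x) = (2 * a) • T x - (a ^ 2 + b ^ 2) • x := by
    have h := congrArg (fun A : Euc n →L[ℝ] Euc n => A x)
      (generalizedDouglasRachford_mul_self U V μ)
    simp only [mul_apply_eq_comp, sub_apply, smul_apply, one_apply_eq_self, hx, map_smul] at h
    rw [← hT] at h
    rw [h, hb, ha]
    module
  refine ⟨⟨a, b⟩, ?_, ?_, ?_⟩
  · rw [mem_complexSpectrum_iff]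
    by_cases h : T x - a • x = 0 ∧ b • x = 0
    · refine ⟨x, 0, Or.inl hx0, ?_, ?_⟩
      · simpa using sub_eq_zero.mp h.1
      · simpa using h.2.symm
    · refine ⟨T x - a • x, b • x, by tauto, ?_, ?_⟩
      · simp only [map_sub, map_smul, hTT]
        module
      · simp only [map_smul]
        module
  · intro h
    have := congrArg Complex.re h
    simp [ha, hμ, hm.ne'] at this
  · rw [← sq_eq_sq₀ (norm_nonneg _) (friedrichsRate_nonneg U V μ), hρ, ← hb,
      ← Complex.normSq_eq_norm_sq, Complex.normSq_mk]
    ring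

theorem subdominantModulus_generalizedDouglasRachford (hUV : U ≠ V) (h0 : 0 < μ) (h2 : μ ≤ 2) :
    subdominantModulus (generalizedDouglasRachford U V μ) = friedrichsRate U V μ := by
  refine IsGreatest.csSup_eq ⟨?_, ?_⟩
  · obtain ⟨z, hz, hz1, h⟩ := exists_mem_complexSpectrum_norm_eq U V hUV h0.ne'
    exact ⟨z, Or.inr ⟨hz, hz1⟩, h⟩
  · rintro _ ⟨z, rfl | ⟨hz, hz1⟩, rfl⟩
    · simpa using friedrichsRate_nonneg U V μ
    · exact norm_le_friedrichsRate_of_mem_complexSpectrum h0.le h2 hz hz1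

end Powers

/-! ### The principal angle after the trivial ones -/

section PrincipalAngles

variable {n : ℕ} {U V : Submodule ℝ (Euc n)} {u v : ℕ → Euc n}

/-- As long as the previous vectors do not span `U ∩ V`, the maximum is `1`, so the maximizing
vectors coincide. -/
theorem principal_vectors_eq {k : ℕ} (h : ∀ i : ℕ, 1 ≤ i → i ≤ k →
    PrincipalAdmissible U V u v i (u i) (v i) ∧
      ∀ x y : Euc n, PrincipalAdmissible U V u v i x y → ⟪x, y⟫_ℝ ≤ ⟪u i, v i⟫_ℝ)
    (i : ℕ) (h1 : 1 ≤ i) (hk : i ≤ k) (hs : i ≤ Module.finrank ℝ ↥(U ⊓ V)) :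
    u i = v i := by
  induction i using Nat.strong_induction_on with
  | _ i ih =>
  have ih' : ∀ j, 1 ≤ j → j < i → u j = v j := fun j hj hji =>
    ih j hji hj (hji.le.trans hk) (hji.le.trans hs)
  set S : Finset (Euc n) := (Finset.Ico 1 i).image u with hS
  set W := Submodule.span ℝ (S : Set (Euc n)) with hW
  have hmem : ∀ j, 1 ≤ j → j < i → u j ∈ W := fun j hj hji =>
    Submodule.subset_span (Finset.mem_coe.mpr
      (Finset.mem_image_of_mem u (Finset.mem_Ico.mpr ⟨hj, hji⟩)))
  have hWle : W ≤ U ⊓ V := by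
    rw [hW, Submodule.span_le]
    intro w hw
    obtain ⟨j, hj, rfl⟩ := Finset.mem_image.mp (Finset.mem_coe.mp hw)
    obtain ⟨hj1, hji⟩ := Finset.mem_Ico.mp hj
    have hadm := (h j hj1 (hji.le.trans hk)).1
    refine ⟨hadm.1, ?_⟩
    rw [ih' j hj1 hji]
    exact hadm.2.1
  have hcard : Module.finrank ℝ W < Module.finrank ℝ ↥(U ⊓ V) := by
    refine lt_of_le_of_lt ((finrank_span_finset_le_card S).trans Finset.card_image_le) ?_
    rw [Nat.card_Ico]
    omega
  have hne : Wᗮ ⊓ (U ⊓ V) ≠ ⊥ := by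
    intro hbot
    have := Submodule.sup_orthogonal_inf_of_hasOrthogonalProjection hWle
    rw [hbot, sup_bot_eq] at this
    rw [this] at hcard
    exact hcard.false
  obtain ⟨w, hw, hw0⟩ := Submodule.exists_mem_ne_zero_of_ne_bot hne
  have hw1 : ‖‖w‖⁻¹ • w‖ = 1 := norm_smul_inv_norm hw0
  have hw' := Submodule.smul_mem _ ‖w‖⁻¹ hw
  set w' := ‖w‖⁻¹ • w
  have horth : ∀ j, 1 ≤ j → j < i → ⟪w', u j⟫_ℝ = 0 := fun j hj hji => by
    rw [real_inner_comm]
    exact hw'.1 _ (hmem j hj hji)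
  obtain ⟨hadm, hmax⟩ := h i h1 hk
  have hle := hmax w' w' ⟨hw'.2.1, hw'.2.2, hw1, hw1, fun j hj hji =>
    ⟨horth j hj hji, by rw [← ih' j hj hji]; exact horth j hj hji⟩⟩
  rw [real_inner_self_eq_norm_sq, hw1, one_pow] at hle
  have hge := real_inner_le_norm (u i) (v i)
  rw [hadm.2.2.1, hadm.2.2.2.1, one_mul] at hge
  exact (inner_eq_one_iff_of_norm_eq_one hadm.2.2.1 hadm.2.2.2.1).mp (le_antisymm hge hle)

/-- The first `dim (U ∩ V)` principal vectors form an orthonormal basis of `U ∩ V`, so that step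
`dim (U ∩ V) + 1` maximizes over the pairs that define the Friedrichs angle. -/
theorem cos_principalAngle_eq_friedrichsCos {θ : ℝ}
    (hθ : IsPrincipalAngle U V (Module.finrank ℝ ↥(U ⊓ V) + 1) θ) :
    Real.cos θ = friedrichsCos U V := by
  obtain ⟨-, u, v, h, rfl⟩ := hθ
  set s := Module.finrank ℝ ↥(U ⊓ V) with hs
  have heq : ∀ i, 1 ≤ i → i ≤ s → u i = v i := fun i h1 hi =>
    principal_vectors_eq h i h1 (by omega) hi
  have hmem : ∀ i, 1 ≤ i → i ≤ s → u i ∈ U ⊓ V := fun i h1 hi => by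
    have hadm := (h i h1 (by omega)).1
    refine ⟨hadm.1, ?_⟩
    rw [heq i h1 hi]
    exact hadm.2.1
  have horth : ∀ i j, 1 ≤ j → j < i → i ≤ s → ⟪u i, u j⟫_ℝ = 0 := fun i j hj hji hi =>
    ((h i (by omega) (by omega)).1.2.2.2.2 j hj hji).1
  have hon : Orthonormal ℝ (fun j : Fin s => u (j + 1)) := by
    refine ⟨fun j => (h _ (by omega) (by omega)).1.2.2.1, fun i j hij => ?_⟩
    rcases lt_or_gt_of_ne (Fin.val_ne_of_ne hij) with hlt | hlt
    · dsimp only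
      rw [real_inner_comm]
      exact horth _ _ (by omega) (by omega) (by omega)
    · exact horth _ _ (by omega) (by omega) (by omega)
  have hspan : Submodule.span ℝ (Set.range fun j : Fin s => u (j + 1)) = U ⊓ V := by
    refine Submodule.eq_of_le_of_finrank_eq ?_ ?_
    · rw [Submodule.span_le]
      rintro _ ⟨j, rfl⟩
      exact hmem _ (by omega) (by omega)
    · rw [finrank_span_eq_card hon.linearIndependent, Fintype.card_fin]
  have hperp (x : Euc n) : (∀ j, 1 ≤ j → j < s + 1 → ⟪x, u j⟫_ℝ = 0) ↔ x ∈ (U ⊓ V)ᗮ := by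
    constructor
    · intro hx
      rw [← hspan, Submodule.mem_orthogonal']
      intro w hw
      induction hw using Submodule.span_induction with
      | mem w hw =>
        obtain ⟨j, rfl⟩ := hw
        exact hx _ (by omega) (by omega)
      | zero => simp
      | add w₁ w₂ _ _ h₁ h₂ => rw [inner_add_right, h₁, h₂, add_zero]
      | smul c w _ hw => rw [inner_smul_right, hw, mul_zero]
    · intro hx j hj hjs
      rw [real_inner_comm]
      exact hx _ (hmem j hj (by omega))
  have hadm_iff (x y : Euc n) : PrincipalAdmissible U V u v (s + 1) x y ↔
      x ∈ U ⊓ (U ⊓ V)ᗮ ∧ y ∈ V ⊓ (U ⊓ V)ᗮ ∧ ‖x‖ = 1 ∧ ‖y‖ = 1 := by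
    constructor
    · rintro ⟨hx, hy, hx1, hy1, hxy⟩
      refine ⟨⟨hx, (hperp x).mp fun j hj hjs => (hxy j hj hjs).1⟩,
        ⟨hy, (hperp y).mp fun j hj hjs => ?_⟩, hx1, hy1⟩
      rw [heq j hj (by omega)]
      exact (hxy j hj hjs).2
    · rintro ⟨hx, hy, hx1, hy1⟩
      refine ⟨hx.1, hy.1, hx1, hy1, fun j hj hjs => ⟨(hperp x).mpr hx.2 j hj hjs, ?_⟩⟩
      rw [← heq j hj (by omega)]
      exact (hperp y).mpr hy.2 j hj hjs
  obtain ⟨hadm, hmax⟩ := h (s + 1) (by omega) le_rfl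
  have hgreat : friedrichsCos U V = ⟪u (s + 1), v (s + 1)⟫_ℝ := by
    refine IsGreatest.csSup_eq ⟨?_, ?_⟩
    · obtain ⟨hx, hy, hx1, hy1⟩ := (hadm_iff _ _).mp hadm
      exact ⟨_, hx, _, hy, hx1, hy1, rfl⟩
    · rintro _ ⟨x, hx, y, hy, hx1, hy1, rfl⟩
      exact hmax x y ((hadm_iff x y).mpr ⟨hx, hy, hx1, hy1⟩)
  rw [← hgreat]
  exact Real.cos_arccos (by linarith [friedrichsCos_nonneg U V]) (friedrichsCos_le_one U V)

theorem cos_friedrichsAngle (U V : Submodule ℝ (Euc n)) :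
    Real.cos (friedrichsAngle U V) = friedrichsCos U V :=
  Real.cos_arccos (by linarith [friedrichsCos_nonneg U V]) (friedrichsCos_le_one U V)

end PrincipalAngles

theorem theorem3p10 {n : ℕ} (U V : Submodule ℝ (Euc n)) (μ : ℝ) :
    IsStarNormal (generalizedDouglasRachford U V μ) ∧
    (U ≠ V → (IsConvergent (generalizedDouglasRachford U V μ) ↔ 0 ≤ μ ∧ μ < 2)) ∧
    (0 < μ → μ < 2 →
      fixedSpace (douglasRachford U V) = (U ⊓ V) ⊔ (Uᗮ ⊓ Vᗮ) ∧
      (U ⊓ V) ⟂ (Uᗮ ⊓ Vᗮ) ∧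
      ConvergesTo (generalizedDouglasRachford U V μ)
        ((U ⊓ V) ⊔ (Uᗮ ⊓ Vᗮ)).starProjection ∧
      (U ≠ V → ∀ θ : ℝ,
        (θ = friedrichsAngle U V ∨
          IsPrincipalAngle U V (Module.finrank ℝ ↥(U ⊓ V) + 1) θ) →
        subdominantModulus (generalizedDouglasRachford U V μ) =
          Real.sqrt (μ * (2 - μ) * Real.cos θ ^ 2 + (1 - μ) ^ 2) ∧
        IsOptimalConvergenceRate (generalizedDouglasRachford U V μ)
          ((U ⊓ V) ⊔ (Uᗮ ⊓ Vᗮ)).starProjection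
          (Real.sqrt (μ * (2 - μ) * Real.cos θ ^ 2 + (1 - μ) ^ 2)))) := by
  refine ⟨isStarNormal_generalizedDouglasRachford U V μ,
    isConvergent_generalizedDouglasRachford_iff U V, fun h0 h2 =>
      ⟨fixedSpace_douglasRachford U V, inf_isOrtho_inf_orthogonal U V,
        convergesTo_generalizedDouglasRachford U V h0 h2, fun hUV θ hθ => ?_⟩⟩
  have hcos : Real.cos θ = friedrichsCos U V := by
    rcases hθ with rfl | hθ
    · exact cos_friedrichsAngle U V
    · exact cos_principalAngle_eq_friedrichsCos hθ
  rw [hcos]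
  exact ⟨subdominantModulus_generalizedDouglasRachford U V hUV h0 h2.le,
    isOptimalConvergenceRate_friedrichsRate U V hUV h0 h2⟩
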